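/- Let $P$ be a random variable with values in $[0,1]$ (for instance with a probability density function $f_P$), and consider the varying binary symmetric channel (VBSC): for a block of $n$ channel uses, crossover probabilities $p_1,\dots,p_n$ are drawn i.i.d. from the distribution of $P$, independently of the input, and, given them, the $i$-th input bit is flipped with probability $p_i$, independently for the different uses. The distribution of $P$ is known to encoder and decoder, but the realizations $p_1,\dots,p_n$ are known to neither. A rate $R\ge 0$ is achievable if there are block codes of length $n$ with $\lceil 2^{nR}\rceil$ messages whose error probability, averaged over uniformly distributed messages, tends to $0$ as $n\to\infty$; the capacity is the supremum of the achievable rates. Let $H_2(p)=-p\log_2 p-(1-p)\log_2(1-p)$, with $0\log_2 0=0$, and let $C_{BSC}(p)$ be the capacity of the binary symmetric channel (BSC) with crossover probability $p$. Then the channel obtained by averaging over $P$ is a BSC with crossover probability $\mathbb{E}[P]$: the transition probabilities satisfy $P_{Y|X}(y|x)=\mathbb{E}[P]$ for $y\ne x$ and $P_{Y|X}(y|x)=1-\mathbb{E}[P]$ for $y=x$, and over a block they are the products of these. The capacity of the VBSC is $$C_{VBSC}=C_{BSC}(\mathbb{E}[P])=1-H_2(\mathbb{E}[P]),$$ and this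 number is also $\max_{P_X} I(X;Y)$, the maximum over the distributions of the input bit $X$ of the mutual information, in bits, between $X$ and the corresponding output $Y$ of the averaged channel. -/

import Mathlib

open MeasureTheory Filter

/-- The binary entropy function `H₂(p) = -p log p - (1 - p) log (1 - p)`, logarithms to base 2. -/
noncomputable def binEntropyTwo (p : ℝ) : ℝ :=
  -p * Real.logb 2 p - (1 - p) * Real.logb 2 (1 - p)

/-- Transition probability `P(y | x)` of one use of the binary symmetric channel with crossover
probability `p`; the binary alphabet `{0, 1}` is `Bool`. -/
noncomputable def bscProb (p : ℝ) (x y : Bool) : ℝ := if y = x then 1 - p else p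

/-- The transition probabilities `P(yⁿ | xⁿ)` of a binary channel, for each block length `n`. -/
abbrev BlockChannel := (n : ℕ) → (Fin n → Bool) → (Fin n → Bool) → ℝ

/-- `n` independent uses of the binary symmetric channel with crossover probability `p`. -/
noncomputable def bscBlock (p : ℝ) : BlockChannel :=
  fun n x y => ∏ i : Fin n, bscProb p (x i) (y i)

/-- The varying binary symmetric channel without channel state information.
The crossover probabilities `p 0, …, p (n - 1)` are drawn i.i.d. from the law `μ`, independently of
the input; given them, the `i`-th symbol passes through a BSC with crossover probability `p i`, with
independent noise in the different uses. As neither encoder nor decoder observes `p`, the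
probability of receiving `y` when `x` is sent is the expectation over `p`. -/
noncomputable def vbscBlock (μ : Measure ℝ) : BlockChannel :=
  fun n x y => ∫ p : Fin n → ℝ, ∏ i : Fin n, bscProb (p i) (x i) (y i) ∂(Measure.pi fun _ => μ)

/-- The averaged channel of a single use of the VBSC with law `μ` of the crossover probability:
`P_{Y|X}(y | x) = 𝔼[P_{Y|X,P}(y | x, P)]`. -/
noncomputable def averagedChannel (μ : Measure ℝ) (x y : Bool) : ℝ := ∫ p, bscProb p x y ∂μ

/-- A block code of length `n` with `M` messages, without channel state information: encoder and
decoder do not see the crossover probabilities. (They may depend on the law of these, since the code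
is chosen for a given channel.) -/
structure BlockCode (M n : ℕ) where
  /-- the encoder -/
  enc : Fin M → Fin n → Bool
  /-- the decoder -/
  dec : (Fin n → Bool) → Fin M

/-- The probability of decoding a uniformly distributed message wrongly. -/
noncomputable def BlockCode.errorProb {M n : ℕ} (c : BlockCode M n) (V : BlockChannel) : ℝ :=
  (∑ m : Fin M, ∑ y : Fin n → Bool, if c.dec y = m then 0 else V n (c.enc m) y) / M

/-- A rate `R ≥ 0` (bits per channel use) is achievable if there are `(⌈2 ^ (n R)⌉, n)` codes whose
error probability tends to `0` as `n → ∞`. -/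
def IsAchievable (V : BlockChannel) (R : ℝ) : Prop :=
  0 ≤ R ∧ ∃ c : (n : ℕ) → BlockCode ⌈(2 : ℝ) ^ ((n : ℝ) * R)⌉₊ n,
    Tendsto (fun n => (c n).errorProb V) atTop (nhds 0)

/-- `C` is the (operational) capacity: the supremum of the achievable rates. -/
def IsCapacity (V : BlockChannel) (C : ℝ) : Prop := IsLUB {R : ℝ | IsAchievable V R} C

/-- The mutual information `I(X;Y)` in bits of a pair `(X, Y)` on finite alphabets
with joint probability mass function `J`. -/
noncomputable def mutualInfo {α β : Type*} [Fintype α] [Fintype β] (J : α → β → ℝ) : ℝ :=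
  ∑ x, ∑ y, J x y * Real.logb 2 (J x y / ((∑ y', J x y') * (∑ x', J x' y)))

/-- The values `I(X;Y)` for all input distributions `P_X`, where `Y` is the output of the
single-use channel `W` on input `X`. -/
def mutualInfoValues (W : Bool → Bool → ℝ) : Set ℝ :=
  {I | ∃ Q ∈ stdSimplex ℝ Bool, I = mutualInfo fun x y => Q x * W x y}

/-! Given the input, the noise in different uses is independent and the crossover probabilities are
i.i.d., so by Fubini averaging over them factorises: unseen by encoder and decoder, the VBSC is
exactly a BSC with parameter `𝔼[P]` (`vbscBlock_eq`). What remains is the coding theorem for the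
BSC. Both halves use Chebyshev's inequality for the information content
(`sum_bscBlock_atypical_le`): outside probability `O(1/n)` the likelihood is within a factor
`2^(nε)` of `2^(-nH)`. Achievability is random coding with a likelihood-threshold decoder
(`exists_code_error_le`). The converse counts: disjoint decoding regions share `2^n` outputs, each
typically worth at most `2^(-n(H-ε))` (`one_sub_errorProb_bsc_le`). -/

open Finset in
/-- Resampling one coordinate of a uniformly random function does not change its law. -/
lemma card_mul_sum_eq_sum_sum_update {ι X : Type*} [Fintype ι] [DecidableEq ι] [Fintype X]
    (i : ι) (g : (ι → X) → ℝ) :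
    (Fintype.card X : ℝ) * ∑ f, g f = ∑ f : ι → X, ∑ x, g (Function.update f i x) := by
  have h1 : (Fintype.card X : ℝ) * ∑ f, g f = ∑ q : (ι → X) × X, g q.1 := by
    rw [Fintype.sum_prod_type]
    simp [Finset.mul_sum]
  rw [h1, ← Fintype.sum_prod_type' (f := fun f x => g (Function.update f i x))]
  -- Swapping the stored value `f i` with the fresh sample `x` is an involution of pairs.
  refine (Function.Involutive.bijective
    (f := fun q : (ι → X) × X => (Function.update q.1 i q.2, q.1 i)) ?_).sum_comp
      (fun q : (ι → X) × X => g q.1) |>.symm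
  rintro ⟨f, x⟩
  simp

open Finset in
/-- Random coding: for a channel `W` and a decoding relation `T`, some code with `M` messages has
an error bounded by the probability `δ` that the sent word is missed, plus the union bound for the
other words. -/
lemma exists_code_error_le {X Y : Type*} [Fintype X] [Nonempty X] [Fintype Y] (W : X → Y → ℝ)
    (hW : ∀ x y, 0 ≤ W x y) (hsum : ∀ x, ∑ y, W x y = 1) (T : X → Y → Prop)
    [∀ x y, Decidable (T x y)] (K δ : ℝ)
    (hK : ∀ y, (#{x | T x y} : ℝ) ≤ K) (hδ : ∀ x, ∑ y, (if T x y then 0 else W x y) ≤ δ)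
    {M : ℕ} (hM : 0 < M) :
    ∃ (enc : Fin M → X) (dec : Y → Fin M),
      ∑ m, ∑ y, (if dec y = m then 0 else W (enc m) y)
        ≤ M * (δ + (M - 1) * (K / Fintype.card X)) := by
  classical
  have hX : (0 : ℝ) < Fintype.card X := by exact_mod_cast Fintype.card_pos
  set B : (Fin M → X) → ℝ := fun enc =>
    ∑ m, ∑ m' ∈ univ.erase m, ∑ y, (if T (enc m') y then W (enc m) y else 0) with hB
  have havg : ∑ enc, B enc ≤ ∑ _enc : Fin M → X, (M : ℝ) * ((M - 1) * (K / Fintype.card X)) := by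
    have hpair : ∀ m, ∀ m' ∈ univ.erase m,
        ∑ enc : Fin M → X, ∑ y, (if T (enc m') y then W (enc m) y else 0)
          ≤ ∑ _enc : Fin M → X, K / Fintype.card X := by
      intro m m' hm'
      have hne : m ≠ m' := (ne_of_mem_erase hm').symm
      refine le_of_mul_le_mul_left ?_ hX
      -- Only the competing word `m'` is resampled; the sent word `m` stays fixed, so the average
      -- over `m'` just counts a column of `T`.
      rw [card_mul_sum_eq_sum_sum_update m', Finset.mul_sum]
      refine sum_le_sum fun enc _ => ?_
      rw [mul_div_cancel₀ _ hX.ne', sum_comm]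
      simp only [Function.update_self, Function.update_of_ne hne]
      calc ∑ y, ∑ x, (if T x y then W (enc m) y else 0)
          = ∑ y, (#{x | T x y} : ℝ) * W (enc m) y := by
            refine sum_congr rfl fun y _ => ?_
            rw [← sum_filter, sum_const, nsmul_eq_mul]
        _ ≤ ∑ y, K * W (enc m) y :=
            sum_le_sum fun y _ => mul_le_mul_of_nonneg_right (hK y) (hW _ _)
        _ = K := by rw [← Finset.mul_sum, hsum, mul_one]
    calc ∑ enc, B enc
        = ∑ m, ∑ m' ∈ univ.erase m, ∑ enc : Fin M → X,
            ∑ y, (if T (enc m') y then W (enc m) y else 0) := by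
          rw [hB, sum_comm]
          exact sum_congr rfl fun m _ => sum_comm
      _ ≤ ∑ m : Fin M, ∑ m' ∈ univ.erase m, ∑ _enc : Fin M → X, K / Fintype.card X :=
          sum_le_sum fun m _ => sum_le_sum (hpair m)
      _ = _ := by
          simp only [sum_const, card_erase_of_mem (mem_univ _), card_univ, Fintype.card_fin,
            nsmul_eq_mul, Nat.cast_sub hM]
          push_cast
          ring
  obtain ⟨enc, -, henc⟩ := exists_le_of_sum_le univ_nonempty havg
  -- Any related message will do, and any default: the bound already charges ties and misses as
  -- errors.
  refine ⟨enc, fun y => if h : ∃ m, T (enc m) y then h.choose else ⟨0, hM⟩, ?_⟩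
  have hpt : ∀ m y, (if (if h : ∃ m, T (enc m) y then h.choose else (⟨0, hM⟩ : Fin M)) = m
      then 0 else W (enc m) y)
      ≤ (if T (enc m) y then 0 else W (enc m) y)
        + ∑ m' ∈ univ.erase m, (if T (enc m') y then W (enc m) y else 0) := by
    intro m y
    have hn : ∀ m' ∈ univ.erase m, 0 ≤ (if T (enc m') y then W (enc m) y else 0) := by
      intro m' _
      split_ifs
      exacts [hW _ _, le_rfl]
    have hs := sum_nonneg hn
    by_cases hT : T (enc m) y
    · have hex : ∃ m, T (enc m) y := ⟨m, hT⟩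
      rw [dif_pos hex, if_pos hT, zero_add]
      split_ifs with hc
      · exact hs
      · have := single_le_sum hn (mem_erase.2 ⟨hc, mem_univ _⟩)
        rwa [if_pos hex.choose_spec] at this
    · rw [if_neg hT]
      have : (if (if h : ∃ m, T (enc m) y then h.choose else (⟨0, hM⟩ : Fin M)) = m
          then 0 else W (enc m) y) ≤ W (enc m) y := by
        split_ifs <;> simp [hW]
      linarith
  calc _ ≤ ∑ m, ∑ y, ((if T (enc m) y then 0 else W (enc m) y)
        + ∑ m' ∈ univ.erase m, (if T (enc m') y then W (enc m) y else 0)) :=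
        sum_le_sum fun m _ => sum_le_sum fun y _ => hpt m y
    _ = ∑ m, ∑ y, (if T (enc m) y then 0 else W (enc m) y) + B enc := by
        simp only [sum_add_distrib, hB]
        congr 1
        exact sum_congr rfl fun m _ => sum_comm
    _ ≤ ∑ _m : Fin M, δ + (M : ℝ) * ((M - 1) * (K / Fintype.card X)) :=
        add_le_add (sum_le_sum fun m _ => hδ _) henc
    _ = _ := by simp [mul_add]

/-- Moments of a sum of independent centered random variables on a product space. -/
lemma sum_prod_mul_sum_sq {α : Type*} [Fintype α] (n : ℕ) (q g : Fin n → α → ℝ) (v : ℝ)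
    (h0 : ∀ i, ∑ a, q i a = 1) (h1 : ∀ i, ∑ a, q i a * g i a = 0)
    (h2 : ∀ i, ∑ a, q i a * g i a ^ 2 = v) :
    ∑ z : Fin n → α, ∏ i, q i (z i) = 1 ∧
    ∑ z : Fin n → α, (∏ i, q i (z i)) * ∑ i, g i (z i) = 0 ∧
    ∑ z : Fin n → α, (∏ i, q i (z i)) * (∑ i, g i (z i)) ^ 2 = n * v := by
  induction n with
  | zero => simp
  | succ n ih =>
    obtain ⟨i0, i1, i2⟩ := ih (fun i => q i.succ) (fun i => g i.succ)
      (fun i => h0 _) (fun i => h1 _) (fun i => h2 _)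
    have key : ∀ F : (Fin (n + 1) → α) → ℝ,
        ∑ z, F z = ∑ a, ∑ z : Fin n → α, F (Fin.cons a z) := by
      intro F
      rw [← (Fin.consEquiv fun _ => α).sum_comp, Fintype.sum_prod_type]
      rfl
    simp only [key, Fin.prod_univ_succ, Fin.sum_univ_succ, Fin.cons_zero, Fin.cons_succ]
    refine ⟨?_, ?_, ?_⟩
    · rw [← Finset.sum_mul_sum, h0, i0, one_mul]
    · calc _ = ∑ a, ∑ z : Fin n → α, ((q 0 a * g 0 a) * ∏ i, q (Fin.succ i) (z i)
            + q 0 a * ((∏ i, q (Fin.succ i) (z i)) * ∑ i, g (Fin.succ i) (z i))) :=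
            Finset.sum_congr rfl fun a _ => Finset.sum_congr rfl fun z _ => by ring
        _ = 0 := by
            simp only [Finset.sum_add_distrib, ← Finset.sum_mul_sum, h1, i1]
            simp
    · calc _ = ∑ a, ∑ z : Fin n → α, ((q 0 a * g 0 a ^ 2) * ∏ i, q (Fin.succ i) (z i)
            + (2 * (q 0 a * g 0 a)) * ((∏ i, q (Fin.succ i) (z i)) * ∑ i, g (Fin.succ i) (z i))
            + q 0 a * ((∏ i, q (Fin.succ i) (z i)) * (∑ i, g (Fin.succ i) (z i)) ^ 2)) :=
            Finset.sum_congr rfl fun a _ => Finset.sum_congr rfl fun z _ => by ring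
        _ = _ := by
            simp only [Finset.sum_add_distrib, ← Finset.sum_mul_sum, h0, h2, i0, i1, i2]
            push_cast
            ring

/-! ### The BSC: moments and typicality -/

section BSC

variable {p : ℝ}

lemma bscProb_nonneg (hp : p ∈ Set.Icc (0 : ℝ) 1) (x y : Bool) : 0 ≤ bscProb p x y := by
  unfold bscProb
  split_ifs <;> linarith [hp.1, hp.2]

lemma bscProb_comm (p : ℝ) (x y : Bool) : bscProb p x y = bscProb p y x := by
  simp [bscProb, eq_comm]

lemma sum_bscProb (p : ℝ) (x : Bool) : ∑ y, bscProb p x y = 1 := by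
  cases x <;> simp [bscProb]

lemma sum_bscProb_mul_logb (p : ℝ) (x : Bool) :
    ∑ y, bscProb p x y * Real.logb 2 (bscProb p x y) = -binEntropyTwo p := by
  cases x <;> simp [bscProb, binEntropyTwo]
  ring

lemma bscBlock_nonneg (hp : p ∈ Set.Icc (0 : ℝ) 1) (n : ℕ) (x y : Fin n → Bool) :
    0 ≤ bscBlock p n x y :=
  Finset.prod_nonneg fun _ _ => bscProb_nonneg hp _ _

lemma bscBlock_comm (p : ℝ) (n : ℕ) (x y : Fin n → Bool) :
    bscBlock p n x y = bscBlock p n y x :=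
  Finset.prod_congr rfl fun _ _ => bscProb_comm _ _ _

/-- The variance of the information content of one noise bit. -/
noncomputable def bscVariance (p : ℝ) : ℝ :=
  ∑ y, bscProb p false y * (-Real.logb 2 (bscProb p false y) - binEntropyTwo p) ^ 2

lemma bscBlock_moments (p : ℝ) (n : ℕ) (x : Fin n → Bool) :
    ∑ y, bscBlock p n x y = 1 ∧
    ∑ y, bscBlock p n x y
      * (∑ i, (-Real.logb 2 (bscProb p (x i) (y i)) - binEntropyTwo p)) ^ 2
        = n * bscVariance p := by
  obtain ⟨h0, -, h2⟩ := sum_prod_mul_sum_sq n (fun i b => bscProb p (x i) b)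
    (fun i b => -Real.logb 2 (bscProb p (x i) b) - binEntropyTwo p) (bscVariance p)
    (fun i => sum_bscProb _ _)
    (fun i => by
      simp only [mul_sub, mul_neg, Finset.sum_sub_distrib, Finset.sum_neg_distrib,
        sum_bscProb_mul_logb, ← Finset.sum_mul, sum_bscProb]
      ring)
    (fun i => by
      cases x i <;> simp [bscVariance, bscProb, add_comm])
  exact ⟨h0, h2⟩

lemma sum_bscBlock (p : ℝ) (n : ℕ) (x : Fin n → Bool) : ∑ y, bscBlock p n x y = 1 :=
  (bscBlock_moments p n x).1

lemma logb_bscBlock {n : ℕ} {x y : Fin n → Bool} (h : bscBlock p n x y ≠ 0) :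
    ∑ i, (-Real.logb 2 (bscProb p (x i) (y i)) - binEntropyTwo p)
      = -Real.logb 2 (bscBlock p n x y) - n * binEntropyTwo p := by
  unfold bscBlock at h ⊢
  rw [Real.logb_prod _ _ (fun i hi => Finset.prod_ne_zero_iff.1 h i hi)]
  simp

/-- Asymptotic equipartition: outputs of atypical likelihood have small probability. -/
lemma sum_bscBlock_atypical_le (hp : p ∈ Set.Icc (0 : ℝ) 1) {ε : ℝ} (hε : 0 < ε) (n : ℕ)
    (x : Fin n → Bool) (A : Set (Fin n → Bool)) [DecidablePred (· ∈ A)]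
    (hA : ∀ y ∈ A, bscBlock p n x y ≠ 0 → 0 < n ∧
      n * ε ≤ |-Real.logb 2 (bscBlock p n x y) - n * binEntropyTwo p|) :
    ∑ y, (if y ∈ A then bscBlock p n x y else 0) ≤ bscVariance p / ε ^ 2 / n := by
  -- At `n = 0` the bound is `0` by the division convention; `0 < n` in `hA` then rules out any mass
  -- on `A`.
  rcases Nat.eq_zero_or_pos n with rfl | hn
  · refine (Finset.sum_nonpos fun y _ => ?_).trans (by simp)
    split_ifs with h
    · by_contra hc
      exact absurd (hA y h (by intro h0; simp [h0] at hc)).1 (lt_irrefl 0)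
    · exact le_rfl
  have hn' : (0 : ℝ) < n := by exact_mod_cast hn
  have h : (n * ε) ^ 2 * ∑ y, (if y ∈ A then bscBlock p n x y else 0) ≤ n * bscVariance p := by
    rw [← (bscBlock_moments p n x).2, Finset.mul_sum]
    refine Finset.sum_le_sum fun y _ => ?_
    have hW := bscBlock_nonneg hp n x y
    split_ifs with hy
    · by_cases h0 : bscBlock p n x y = 0
      · simp [h0]
      · rw [logb_bscBlock h0, mul_comm]
        refine mul_le_mul_of_nonneg_left ?_ hW
        rw [← sq_abs (_ - _)]
        exact pow_le_pow_left₀ (by positivity) (hA y hy h0).2 2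
    · rw [mul_zero]
      positivity
  rw [div_div, le_div_iff₀ (by positivity)]
  refine le_of_mul_le_mul_left ?_ hn'
  linarith

lemma binEntropyTwo_eq (p : ℝ) : binEntropyTwo p = Real.binEntropy p / Real.log 2 := by
  simp only [binEntropyTwo, Real.binEntropy, Real.logb, Real.log_inv]
  ring

lemma binEntropyTwo_le_one (p : ℝ) : binEntropyTwo p ≤ 1 := by
  rw [binEntropyTwo_eq, div_le_one (Real.log_pos one_lt_two)]
  exact Real.binEntropy_le_log_two

lemma BlockCode.errorProb_nonneg {M n : ℕ} (c : BlockCode M n) {V : BlockChannel}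
    (hV : ∀ x y, 0 ≤ V n x y) : 0 ≤ c.errorProb V := by
  refine div_nonneg (Finset.sum_nonneg fun m _ => Finset.sum_nonneg fun y _ => ?_) (by positivity)
  split_ifs
  exacts [le_rfl, hV _ _]

/-- With a single message no error is possible. This makes every upper bound of the achievable rates
nonnegative. -/
lemma isAchievable_zero (V : BlockChannel) : IsAchievable V 0 := by
  have h1 : ∀ n : ℕ, ⌈(2 : ℝ) ^ ((n : ℝ) * 0)⌉₊ = 1 := by simp
  have hs : ∀ n : ℕ, Subsingleton (Fin ⌈(2 : ℝ) ^ ((n : ℝ) * 0)⌉₊) := by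
    intro n
    rw [h1]
    infer_instance
  refine ⟨le_rfl, fun n => ⟨fun _ _ => false, fun _ => ⟨0, by simp⟩⟩, ?_⟩
  refine tendsto_const_nhds.congr fun n => ?_
  rw [BlockCode.errorProb, Finset.sum_eq_zero, zero_div]
  exact fun m _ => Finset.sum_eq_zero fun y _ => if_pos ((hs n).elim _ _)

/-! ### Achievability -/

open Finset in
lemma exists_blockCode_bsc (hp : p ∈ Set.Icc (0 : ℝ) 1) {ε R : ℝ} (hε : 0 < ε) (n : ℕ) :
    ∃ c : BlockCode ⌈(2 : ℝ) ^ ((n : ℝ) * R)⌉₊ n, c.errorProb (bscBlock p)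
      ≤ bscVariance p / ε ^ 2 / n + (2 : ℝ) ^ (-(n * (1 - binEntropyTwo p - R - ε))) := by
  classical
  set M := ⌈(2 : ℝ) ^ ((n : ℝ) * R)⌉₊ with hMdef
  have hpos : (0 : ℝ) < (2 : ℝ) ^ ((n : ℝ) * R) := by positivity
  have hM : 0 < M := Nat.ceil_pos.2 hpos
  -- Decoding threshold. By symmetry of the BSC the likelihoods of `y` sum to one over the inputs,
  -- so at most `θ⁻¹` words pass it.
  set θ : ℝ := (2 : ℝ) ^ (-(n * (binEntropyTwo p + ε))) with hθ
  have hθ0 : 0 < θ := by positivity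
  obtain ⟨enc, dec, h⟩ := exists_code_error_le (bscBlock p n) (bscBlock_nonneg hp n)
    (sum_bscBlock p n) (fun x y => θ ≤ bscBlock p n x y) θ⁻¹ (bscVariance p / ε ^ 2 / n)
    (fun y => by
      rw [← one_div, le_div_iff₀ hθ0]
      calc (#{x | θ ≤ bscBlock p n x y} : ℝ) * θ
          = ∑ x with θ ≤ bscBlock p n x y, θ := by rw [sum_const, nsmul_eq_mul]
        _ ≤ ∑ x with θ ≤ bscBlock p n x y, bscBlock p n x y :=
            sum_le_sum fun x hx => (mem_filter.1 hx).2
        _ ≤ ∑ x, bscBlock p n x y :=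
            sum_le_sum_of_subset_of_nonneg (filter_subset _ _)
              fun x _ _ => bscBlock_nonneg hp n x y
        _ = 1 := by
            simp only [bscBlock_comm p n _ y]
            exact sum_bscBlock p n y)
    (fun x => by
      refine le_trans (le_of_eq ?_)
        (sum_bscBlock_atypical_le hp hε n x {y | bscBlock p n x y < θ} ?_)
      · refine sum_congr rfl fun y _ => ?_
        by_cases hy : θ ≤ bscBlock p n x y
        · simp [hy, not_lt.2 hy]
        · simp [hy, not_le.1 hy]
      · intro y hy h0
        have hW : 0 < bscBlock p n x y := lt_of_le_of_ne (bscBlock_nonneg hp n x y) (Ne.symm h0)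
        constructor
        · by_contra hn
          obtain rfl : n = 0 := by omega
          simp [hθ, bscBlock] at hy
        · have hl := Real.logb_lt_logb one_lt_two hW hy
          rw [hθ, Real.logb_rpow two_pos (by norm_num)] at hl
          exact le_trans (by linarith) (le_abs_self _))
    hM
  refine ⟨⟨enc, dec⟩, ?_⟩
  have hM' : (0 : ℝ) < M := by exact_mod_cast hM
  -- There are only `M - 1` competitors, so the ceiling costs nothing.
  have hM1 : (M : ℝ) - 1 ≤ (2 : ℝ) ^ ((n : ℝ) * R) := by
    have := Nat.ceil_lt_add_one hpos.le
    linarith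
  have hc : (2 : ℝ) ^ (-(n * (1 - binEntropyTwo p - R - ε)))
      = (2 : ℝ) ^ ((n : ℝ) * R) * (θ⁻¹ / Fintype.card (Fin n → Bool)) := by
    have : ((Fintype.card (Fin n → Bool) : ℕ) : ℝ) = (2 : ℝ) ^ (n : ℝ) := by simp
    rw [this, hθ, ← Real.rpow_neg two_pos.le, ← Real.rpow_sub two_pos, ← Real.rpow_add two_pos]
    congr 1
    ring
  rw [BlockCode.errorProb, div_le_iff₀ hM', mul_comm, hc]
  refine h.trans ?_
  gcongr

lemma tendsto_two_rpow_neg_mul {a : ℝ} (ha : 0 < a) :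
    Tendsto (fun n : ℕ => (2 : ℝ) ^ (-((n : ℝ) * a))) atTop (nhds 0) := by
  have h : Tendsto (fun n : ℕ => ((2 : ℝ) ^ (-a)) ^ n) atTop (nhds 0) :=
    tendsto_pow_atTop_nhds_zero_of_lt_one (by positivity)
      (Real.rpow_lt_one_of_one_lt_of_neg one_lt_two (neg_lt_zero.2 ha))
  refine h.congr fun n => ?_
  rw [← Real.rpow_natCast, ← Real.rpow_mul two_pos.le]
  congr 1
  ring

lemma isAchievable_bsc_of_lt (hp : p ∈ Set.Icc (0 : ℝ) 1) {R : ℝ} (hR : 0 ≤ R)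
    (h : R < 1 - binEntropyTwo p) : IsAchievable (bscBlock p) R := by
  -- Half the gap is the typicality slack; the other half is the decay exponent.
  have hε : 0 < (1 - binEntropyTwo p - R) / 2 := by linarith
  choose c hc using fun n => exists_blockCode_bsc hp (R := R) hε n
  refine ⟨hR, c, squeeze_zero (fun n => (c n).errorProb_nonneg (bscBlock_nonneg hp n)) hc ?_⟩
  have h1 := tendsto_const_div_atTop_nhds_zero_nat
    (bscVariance p / ((1 - binEntropyTwo p - R) / 2) ^ 2)
  have h2 := tendsto_two_rpow_neg_mul
    (a := 1 - binEntropyTwo p - R - (1 - binEntropyTwo p - R) / 2) (by linarith)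
  simpa using h1.add h2

/-! ### Converse -/

lemma one_sub_errorProb_bsc_le (hp : p ∈ Set.Icc (0 : ℝ) 1) {ε : ℝ} (hε : 0 < ε) {M n : ℕ}
    (hM : 0 < M) (hn : 0 < n) (c : BlockCode M n) :
    1 - c.errorProb (bscBlock p)
      ≤ bscVariance p / ε ^ 2 / n + (2 : ℝ) ^ (n * (1 - binEntropyTwo p + ε)) / M := by
  classical
  have hM' : (0 : ℝ) < M := by exact_mod_cast hM
  set θ : ℝ := (2 : ℝ) ^ (-(n * (binEntropyTwo p - ε))) with hθ
  have hθ0 : 0 < θ := by positivity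
  have hsucc : 1 - c.errorProb (bscBlock p)
      = (∑ m, ∑ y, if c.dec y = m then bscBlock p n (c.enc m) y else 0) / M := by
    have : (∑ m, ∑ y, if c.dec y = m then bscBlock p n (c.enc m) y else 0)
        + (∑ m, ∑ y, if c.dec y = m then 0 else bscBlock p n (c.enc m) y) = M := by
      simp only [← Finset.sum_add_distrib]
      calc _ = ∑ m : Fin M, ∑ y, bscBlock p n (c.enc m) y :=
            Finset.sum_congr rfl fun m _ => Finset.sum_congr rfl fun y _ => by split_ifs <;> simp
        _ = M := by simp [sum_bscBlock]
    rw [BlockCode.errorProb, eq_div_iff hM'.ne', sub_mul, div_mul_cancel₀ _ hM'.ne']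
    linarith
  have htail : ∀ x : Fin n → Bool,
      ∑ y, (if y ∈ {y | θ < bscBlock p n x y} then bscBlock p n x y else 0)
        ≤ bscVariance p / ε ^ 2 / n := by
    refine fun x => sum_bscBlock_atypical_le hp hε n x _ fun y hy h0 => ⟨hn, ?_⟩
    have hl := Real.logb_lt_logb one_lt_two hθ0 hy
    rw [hθ, Real.logb_rpow two_pos (by norm_num)] at hl
    exact le_trans (by linarith) (neg_le_abs _)
  have hcard : (2 : ℝ) ^ (n * (1 - binEntropyTwo p + ε)) = ∑ _y : Fin n → Bool, θ := by
    have : ((Fintype.card (Fin n → Bool) : ℕ) : ℝ) = (2 : ℝ) ^ (n : ℝ) := by simp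
    rw [Finset.sum_const, nsmul_eq_mul, Finset.card_univ, this, hθ, ← Real.rpow_add two_pos]
    congr 1
    ring
  rw [hsucc, div_le_iff₀ hM', add_mul, div_mul_cancel₀ _ hM'.ne', hcard]
  -- A correctly decoded `y` is either atypically likely or contributes at most `θ`; since `y` is
  -- decoded to one message only, the second kind totals at most `2^n θ`.
  calc _ ≤ ∑ m, ∑ y, ((if y ∈ {y | θ < bscBlock p n (c.enc m) y}
          then bscBlock p n (c.enc m) y else 0) + if c.dec y = m then θ else 0) := by
        refine Finset.sum_le_sum fun m _ => Finset.sum_le_sum fun y _ => ?_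
        have hW := bscBlock_nonneg hp n (c.enc m) y
        simp only [Set.mem_ofPred_eq]
        split_ifs <;> linarith
    _ ≤ ∑ _m : Fin M, bscVariance p / ε ^ 2 / n
          + ∑ m, ∑ y, (if c.dec y = m then θ else 0) := by
        simp only [Finset.sum_add_distrib]
        gcongr with m
        exact htail _
    _ = _ := by
        rw [Finset.sum_comm (γ := Fin M)]
        simp [mul_comm]

lemma le_of_isAchievable_bsc (hp : p ∈ Set.Icc (0 : ℝ) 1) {R : ℝ}
    (h : IsAchievable (bscBlock p) R) : R ≤ 1 - binEntropyTwo p := by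
  obtain ⟨-, c, hc⟩ := h
  by_contra! hlt
  have hε : 0 < (R - (1 - binEntropyTwo p)) / 2 := by linarith
  have h1 := tendsto_const_div_atTop_nhds_zero_nat
    (bscVariance p / ((R - (1 - binEntropyTwo p)) / 2) ^ 2)
  have h2 := tendsto_two_rpow_neg_mul hε
  -- Error plus success is one, yet all three bounding terms vanish in the limit.
  have h3 := ge_of_tendsto ((hc.add h1).add h2) (b := 1) (by
    filter_upwards [eventually_gt_atTop 0] with n hn
    have hpos : (0 : ℝ) < (2 : ℝ) ^ ((n : ℝ) * R) := by positivity
    have hb := one_sub_errorProb_bsc_le hp hε (Nat.ceil_pos.2 hpos) hn (c n)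
    have hd : (2 : ℝ) ^ (n * (1 - binEntropyTwo p + (R - (1 - binEntropyTwo p)) / 2))
        / (⌈(2 : ℝ) ^ ((n : ℝ) * R)⌉₊ : ℝ)
        ≤ (2 : ℝ) ^ (-((n : ℝ) * ((R - (1 - binEntropyTwo p)) / 2))) := by
      refine (div_le_div_of_nonneg_left (by positivity) hpos (Nat.le_ceil _)).trans
        (le_of_eq ?_)
      rw [← Real.rpow_sub two_pos]
      congr 1
      ring
    linarith)
  norm_num at h3

/-- The channel coding theorem for the binary symmetric channel. -/
theorem isCapacity_bscBlock (hp : p ∈ Set.Icc (0 : ℝ) 1) :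
    IsCapacity (bscBlock p) (1 - binEntropyTwo p) := by
  refine ⟨fun R hR => le_of_isAchievable_bsc hp hR, fun b hb => ?_⟩
  have hb0 : 0 ≤ b := hb (isAchievable_zero _)
  by_contra! hlt
  have := hb (isAchievable_bsc_of_lt hp (R := (b + (1 - binEntropyTwo p)) / 2)
    (by linarith) (by linarith))
  linarith

/-! ### Mutual information -/

/-- The mutual information across a BSC is the output entropy minus the noise entropy. -/
lemma mutualInfo_bsc (hp : p ∈ Set.Icc (0 : ℝ) 1) {Q : Bool → ℝ} (hQ : Q ∈ stdSimplex ℝ Bool) :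
    mutualInfo (fun x y => Q x * bscProb p x y)
      = binEntropyTwo (∑ x, Q x * bscProb p x true) - binEntropyTwo p := by
  obtain ⟨hQ0, hQ1⟩ := hQ
  set r : Bool → ℝ := fun y => ∑ x, Q x * bscProb p x y with hr
  have hnn : ∀ x y, 0 ≤ Q x * bscProb p x y := fun x y =>
    mul_nonneg (hQ0 x) (bscProb_nonneg hp x y)
  have hterm : ∀ x y, Q x * bscProb p x y * Real.logb 2 (Q x * bscProb p x y
      / ((∑ y', Q x * bscProb p x y') * r y))
      = Q x * (bscProb p x y * Real.logb 2 (bscProb p x y))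
        - Q x * bscProb p x y * Real.logb 2 (r y) := by
    intro x y
    by_cases h0 : Q x * bscProb p x y = 0
    · rw [← mul_assoc, h0]
      simp
    · obtain ⟨hq, hw⟩ := mul_ne_zero_iff.1 h0
      have hry : r y ≠ 0 := by
        refine (lt_of_lt_of_le (lt_of_le_of_ne (hnn x y) (Ne.symm h0)) ?_).ne'
        exact Finset.single_le_sum (f := fun x => Q x * bscProb p x y)
          (fun x _ => hnn x y) (Finset.mem_univ x)
      rw [← Finset.mul_sum, sum_bscProb, mul_one, mul_div_mul_left _ _ hq,
        Real.logb_div hw hry]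
      ring
  have hr1 : r false = 1 - r true := by
    simp only [hr, Fintype.sum_bool, bscProb] at hQ1 ⊢
    simp only [reduceCtorEq, if_true, if_false]
    linear_combination hQ1
  calc mutualInfo (fun x y => Q x * bscProb p x y)
      = ∑ x, ∑ y, (Q x * (bscProb p x y * Real.logb 2 (bscProb p x y))
        - Q x * bscProb p x y * Real.logb 2 (r y)) :=
        Finset.sum_congr rfl fun x _ => Finset.sum_congr rfl fun y _ => hterm x y
    _ = -binEntropyTwo p - ∑ y, r y * Real.logb 2 (r y) := by
        simp only [Finset.sum_sub_distrib]
        rw [Finset.sum_comm (f := fun x y => Q x * bscProb p x y * Real.logb 2 (r y))]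
        simp only [← Finset.mul_sum, sum_bscProb_mul_logb, ← Finset.sum_mul, hQ1, one_mul]
        rfl
    _ = _ := by
        change _ = binEntropyTwo (r true) - binEntropyTwo p
        rw [Fintype.sum_bool, hr1, binEntropyTwo.eq_1 (r true)]
        ring

/-- Output entropy is at most one bit, and the uniform input attains it by making the output
uniform. -/
lemma isGreatest_mutualInfoValues_bsc (hp : p ∈ Set.Icc (0 : ℝ) 1) :
    IsGreatest (mutualInfoValues (bscProb p)) (1 - binEntropyTwo p) := by
  constructor
  · have hQ : (fun _ => 1 / 2 : Bool → ℝ) ∈ stdSimplex ℝ Bool :=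
      ⟨fun _ => by norm_num, by norm_num⟩
    refine ⟨_, hQ, ?_⟩
    have h2 : ∑ x : Bool, 1 / 2 * bscProb p x true = (2 : ℝ)⁻¹ := by
      simp [bscProb]
      ring
    rw [mutualInfo_bsc hp hQ, h2, binEntropyTwo_eq 2⁻¹, Real.binEntropy_two_inv,
      div_self (Real.log_pos one_lt_two).ne']
  · rintro I ⟨Q, hQ, rfl⟩
    rw [mutualInfo_bsc hp hQ]
    linarith [binEntropyTwo_le_one (∑ x, Q x * bscProb p x true)]

end BSC

/-! ### Reduction of the VBSC to the BSC -/

lemma averagedChannel_eq {μ : Measure ℝ} [IsProbabilityMeasure μ] (hμ : Integrable id μ) :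
    averagedChannel μ = bscProb (∫ p, p ∂μ) := by
  have hμ' : Integrable (fun p : ℝ => p) μ := hμ
  ext x y
  unfold averagedChannel bscProb
  split_ifs
  · rw [integral_sub (integrable_const _) hμ']
    simp
  · rfl

lemma vbscBlock_eq {μ : Measure ℝ} [IsProbabilityMeasure μ] (hμ : Integrable id μ) :
    vbscBlock μ = bscBlock (∫ p, p ∂μ) := by
  ext n x y
  unfold vbscBlock bscBlock
  rw [integral_fintype_prod_eq_prod (fun i p => bscProb p (x i) (y i)), ← averagedChannel_eq hμ]
  rfl

theorem mainTheorem4 {Ω : Type*} [MeasurableSpace Ω] (ℙ : Measure Ω) [IsProbabilityMeasure ℙ]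
    (P : Ω → ℝ) (hP : AEMeasurable P ℙ) (hP01 : ∀ᵐ ω ∂ℙ, P ω ∈ Set.Icc (0 : ℝ) 1) :
    -- the averaged channel is a BSC with crossover probability `𝔼[P]`, in each use and per block
    averagedChannel (ℙ.map P) = bscProb (∫ ω, P ω ∂ℙ) ∧
    vbscBlock (ℙ.map P) = bscBlock (∫ ω, P ω ∂ℙ) ∧
    -- the capacity of the VBSC equals that of this BSC, and its value is `1 - H₂(𝔼[P])`
    IsCapacity (vbscBlock (ℙ.map P)) (1 - binEntropyTwo (∫ ω, P ω ∂ℙ)) ∧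
    IsCapacity (bscBlock (∫ ω, P ω ∂ℙ)) (1 - binEntropyTwo (∫ ω, P ω ∂ℙ)) ∧
    -- and it is the maximum of `I(X;Y)` over the input distributions
    IsGreatest (mutualInfoValues (averagedChannel (ℙ.map P)))
      (1 - binEntropyTwo (∫ ω, P ω ∂ℙ)) := by
  have hint : Integrable P ℙ := Integrable.of_mem_Icc 0 1 hP hP01
  have : IsProbabilityMeasure (ℙ.map P) := Measure.isProbabilityMeasure_map hP
  have hid : Integrable id (ℙ.map P) :=
    (integrable_map_measure aestronglyMeasurable_id hP).2 hint
  have hmean : ∫ p, p ∂(ℙ.map P) = ∫ ω, P ω ∂ℙ := integral_map hP aestronglyMeasurable_id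
  have hp : ∫ ω, P ω ∂ℙ ∈ Set.Icc (0 : ℝ) 1 := by
    refine ⟨integral_nonneg_of_ae (hP01.mono fun ω h => h.1), ?_⟩
    simpa using integral_mono_ae hint (integrable_const (1 : ℝ)) (hP01.mono fun ω h => h.2)
  rw [averagedChannel_eq hid, vbscBlock_eq hid, hmean]
  exact ⟨rfl, rfl, isCapacity_bscBlock hp, isCapacity_bscBlock hp,
    isGreatest_mutualInfoValues_bsc hp⟩
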